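/- Let $G$ be a finite group and let $S$ be a supercharacter theory of $G$: a partition $\mathcal X$ of the set $\mathrm{Irr}(G)$ of irreducible complex characters and a partition $\mathcal Y$ of $G$ such that $\{1\}\in\mathcal Y$, $|\mathcal X|=|\mathcal Y|$, and for each $X\in\mathcal X$ the function $\sigma_X=\sum_{\chi\in X}\chi(1)\chi$ is constant on each member of $\mathcal Y$. The functions $\sigma_X$ are the supercharacters and the members of $\mathcal Y$ are the superclasses ($S$-classes); $\mathrm{Cl}_S(g)$ denotes the superclass containing $g$. A subgroup of $G$ is $S$-normal if it is a union of superclasses. Let $[G,S]$ be the subgroup generated by all $g^{-1}k$ with $g\in G$, $k\in \mathrm{Cl}_S(g)$. For a subgroup $H$, let $\mathrm{Irr}(S\mid H)$ be the set of supercharacters $\sigma$ whose kernel $\{g:\sigma(g)=\sigma(1)\}$ does not contain $H$. An element $g$ is an $S$-Camina element if $\sigma(g)=0$ for all $\sigma\in\mathrm{Irr}(S\mid[G,S])$. For an $S$-normal subgroup $N$, $(G,N)$ is a generalized $S$-Camina pair if every element of $G\setminus N$ is an $S$-Camina element. For subgroups $M\le N$ of $G$ with $M$ normal in $G$, $S$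 is a $\Delta$-product over $M$ and $N$ if there are a supercharacter theory $C$ of $N$ and a supercharacter theory $D$ of $G/M$ such that every $C$-class is invariant under conjugation by $G$, $M$ is $C$-normal, $N/M$ is $D$-normal, the images of the $C$-classes in $N/M$ are exactly the $D$-classes contained in $N/M$, and the superclasses of $S$ are exactly the $C$-classes together with the preimages in $G$ of the $D$-classes not contained in $N/M$. Theorem. Let $N$ be an $S$-normal subgroup of $G$. Then the following are equivalent: 1. $(G,N)$ is a generalized $S$-Camina pair. 2. $[G,S]\le N$ and $S$ is a $\Delta$-product over $[G,S]$ and $N$. 3. $|\mathrm{Cl}_S(g)|=|[G,S]|$ for all $g\in G\setminus N$. 4. For all $g\in G\setminus N$ and $z\in[G,S]$ there exists $y\in\mathrm{Cl}_S(g)$ such that $g^{-1}y=z$. 5. Every supercharacter in $\mathrm{Irr}(S\mid[G,S])$ vanishes on $G\setminus N$. -/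

import Mathlib

noncomputable section

/-- `Irr(G)`: the set of complex-valued functions on `G` that are the character of an irreducible
finite-dimensional complex representation of `G`. -/
def irr (G : Type*) [Group G] : Set (G → ℂ) :=
  {χ | ∃ (n : ℕ) (ρ : Representation ℂ G (Fin n → ℂ)), ρ.IsIrreducible ∧ ρ.character = χ}

/-- For a set `X` of irreducible characters, `σ_X = ∑_{χ ∈ X} χ(1) χ`. -/
def sigma {G : Type*} [Group G] (X : Set (irr G)) : G → ℂ :=
  fun g => ∑ᶠ χ ∈ X, (χ : G → ℂ) 1 * (χ : G → ℂ) g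

/-- A supercharacter theory of a (finite) group `G`. -/
structure SupercharacterTheory (G : Type*) [Group G] where
  /-- the parts of the partition of `Irr(G)` -/
  charParts : Set (Set (irr G))
  /-- the superclasses, i.e. the parts of the partition of `G` -/
  classes : Set (Set G)
  charParts_isPartition : Setoid.IsPartition charParts
  classes_isPartition : Setoid.IsPartition classes
  singleton_one_mem : {1} ∈ classes
  encard_eq : charParts.encard = classes.encard
  sigma_const : ∀ X ∈ charParts, ∀ K ∈ classes, ∀ g ∈ K, ∀ h ∈ K, sigma X g = sigma X h

namespace SupercharacterTheory

variable {G : Type*} [Group G]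

/-- `Irr(S)`: the set of supercharacters. -/
def supercharacters (S : SupercharacterTheory G) : Set (G → ℂ) :=
  sigma '' S.charParts

/-- `Cl_S(g)`: the superclass containing `g`. -/
def cl (S : SupercharacterTheory G) (g : G) : Set G :=
  {x | ∃ K ∈ S.classes, g ∈ K ∧ x ∈ K}

/-- `N` is `S`-normal: it is a union of superclasses. -/
def IsSNormal (S : SupercharacterTheory G) (N : Subgroup G) : Prop :=
  ∃ 𝒦 ⊆ S.classes, (N : Set G) = ⋃₀ 𝒦

/-- `[H, S]`: the subgroup generated by all `g⁻¹ k` with `g ∈ H` and `k ∈ Cl_S(g)`. -/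
def commutator (S : SupercharacterTheory G) (H : Subgroup G) : Subgroup G :=
  Subgroup.closure {x | ∃ g ∈ H, ∃ k ∈ S.cl g, x = g⁻¹ * k}

/-- `Irr(S | N)`: the supercharacters whose kernel `{g | σ(g) = σ(1)}` does not contain `N`. -/
def supercharactersOver (S : SupercharacterTheory G) (N : Subgroup G) : Set (G → ℂ) :=
  {σ ∈ S.supercharacters | ¬ (N : Set G) ⊆ {g | σ g = σ 1}}

/-- `g` is an `S`-Camina element: every member of `Irr(S | [G,S])` vanishes at `g`. -/
def IsCaminaElement (S : SupercharacterTheory G) (g : G) : Prop :=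
  ∀ σ ∈ S.supercharactersOver (S.commutator ⊤), σ g = 0

/-- `(G, N)` is a generalized `S`-Camina pair. -/
def IsGCP (S : SupercharacterTheory G) (N : Subgroup G) : Prop :=
  S.IsSNormal N ∧ ∀ g ∉ N, S.IsCaminaElement g

/-- `S = C Δ D`, where `M ≤ N`, `M` is normal in `G`, `C` is a supercharacter theory of `N` and
`D` is a supercharacter theory of `G/M`. The data `C`, `D` are admissible for the product if `C`
is invariant under conjugation in `G` (each `C`-class is), `M` is `C`-normal, `N/M` is `D`-normal,
and `C` and `D` induce the same superclasses on `N/M`. The superclasses of the product are the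
`C`-classes and the preimages in `G` of the `D`-classes lying outside `N/M`. -/
structure IsDeltaProductOf (S : SupercharacterTheory G) (M N : Subgroup G) [M.Normal]
    (C : SupercharacterTheory N) (D : SupercharacterTheory (G ⧸ M)) : Prop where
  le : M ≤ N
  invariant : ∀ K ∈ C.classes, ∀ g : G, ∀ x ∈ K, ∃ y ∈ K, (y : G) = g * x * g⁻¹
  isSNormal_left : C.IsSNormal (M.subgroupOf N)
  isSNormal_right : D.IsSNormal (N.map (QuotientGroup.mk' M))
  compatible :
    (fun K : Set N => (fun x : N => ((x : G) : G ⧸ M)) '' K) '' C.classes =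
      {L ∈ D.classes | L ⊆ (N.map (QuotientGroup.mk' M) : Set (G ⧸ M))}
  classes_eq :
    S.classes = (fun K : Set N => ((↑) : N → G) '' K) '' C.classes ∪
      (fun L : Set (G ⧸ M) => ((↑) : G → G ⧸ M) ⁻¹' L) ''
        {L ∈ D.classes | ¬ L ⊆ (N.map (QuotientGroup.mk' M) : Set (G ⧸ M))}

/-- `S` is a Δ-product over `M` and `N` (in particular `M ≤ N`, and `M` is normal in `G`). -/
def IsDeltaProduct (S : SupercharacterTheory G) (M N : Subgroup G) : Prop :=
  ∃ (_ : M.Normal) (C : SupercharacterTheory N) (D : SupercharacterTheory (G ⧸ M)),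
    S.IsDeltaProductOf M N C D

end SupercharacterTheory

end

/-!
Write `A` for the space of functions on `G` that are constant on the superclasses of `S`. Under
convolution `∗`, the functions `χ(1)χ/|G|` with `χ ∈ Irr(G)` are orthogonal idempotents that form a
basis of the class functions and sum to the unit `δ₁`, so the class functions form a copy of
`ℂ^Irr(G)` (`charTransformInv`, `conv_charTransformInv`, `charTransformInv_charTransform`). Since
`|𝒳| = |𝒴|`, the space `A` corresponds to the functions on `Irr(G)` constant on the parts of `𝒳`
(`map_constFun_charRel`). Hence `A` is a convolution algebra, stable under `f*(g) = conj f(g⁻¹)`: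
products and inverses of superclasses are unions of superclasses, and `M = [G,S]` is `S`-normal
(`isSNormal_commutator`).

Each supercharacter `σ` is an eigenvector of convolution by any `f ∈ A`. With `f` the indicator
function of `M` this shows that `σ` is constant on the cosets of `M` if `M ≤ ker σ`, and that
otherwise its sum over every coset is zero (`sigma_mul_eq_or_sum_eq_zero`). Hence all
`σ ∈ Irr(S | M)` vanish at `g` exactly when `gM ⊆ Cl_S(g)` (`rel_mul_iff_vanish`): if `gM ⊆ Cl_S(g)`, a coset sum at `g` is
`|M| σ(g)`; conversely, if these `σ` vanish at `g`, then for every supercharacter, and so for every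
function in `A`, the value at `g` is the average over `gM`, and the indicator function of `Cl_S(g)`
can be used. Always `Cl_S(g) ⊆ g[G,S]`, so all conditions but the one on Δ-products say that
`Cl_S(g) = g[G,S]` for `g ∉ N`.

Superclasses of a Δ-product outside `N` are unions of cosets of `M` by definition. For the converse,
the factors are the restriction of `S` to `N` and the quotient of `S` by `M`. That these are
supercharacter theories follows from a criterion (`exists_classes_eq`): a partition of a finite
group into unions of conjugacy classes, one of them `{1}`, is the superclass partition of a
supercharacter theory as soon as the functions constant on its parts are closed under convolution,
because a subalgebra of `ℂ^Irr(G)` consists of the functions constant on the parts of a partition.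
-/

open scoped ComplexConjugate

/-! ### Convolution of functions on a finite group -/

section Convolution

variable {G : Type*} [Group G] [Fintype G]

/-- The convolution product `(f ∗ h)(g) = ∑ₓ f(x) h(x⁻¹g)` of functions on a finite group. -/
def conv (f h : G → ℂ) : G → ℂ := fun g => ∑ x, f x * h (x⁻¹ * g)

/-- `f` is a class function. -/
def IsClassFunction (f : G → ℂ) : Prop := ∀ g x, f (x * g * x⁻¹) = f g

/-- The involution `f*(g) = conj f(g⁻¹)` of the convolution algebra. -/
def convStar (f : G → ℂ) : G → ℂ := fun g => conj (f g⁻¹)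

theorem IsClassFunction.conv {f h : G → ℂ} (hf : IsClassFunction f) (hh : IsClassFunction h) :
    IsClassFunction (conv f h) := by
  intro g y
  refine Fintype.sum_equiv (MulAut.conj y⁻¹).toEquiv _ _ fun x => ?_
  have h1 := hf x y⁻¹
  have h2 := hh (x⁻¹ * (y * g * y⁻¹)) y⁻¹
  simp only [inv_inv, MulAut.conj_apply, MulEquiv.toEquiv_eq_coe, MulEquiv.coe_toEquiv,
    mul_inv_rev] at h1 h2 ⊢
  rw [h1, ← h2]
  simp [mul_assoc]

omit [Fintype G] in
theorem IsClassFunction.convStar {f : G → ℂ} (hf : IsClassFunction f) :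
    IsClassFunction (convStar f) := by
  intro g y
  have := hf g⁻¹ y
  simp only [_root_.convStar, mul_inv_rev, inv_inv, ← mul_assoc] at this ⊢
  rw [this]

theorem convStar_conv (f h : G → ℂ) : convStar (conv f h) = conv (convStar h) (convStar f) := by
  ext g
  simp only [convStar, conv, map_sum, map_mul]
  refine Fintype.sum_equiv (Equiv.mulLeft g) _ _ fun x => ?_
  simp [mul_comm]

omit [Fintype G] in
@[simp] theorem convStar_convStar (f : G → ℂ) : convStar (convStar f) = f := by
  ext g; simp [convStar]

/-- Positivity: the value of `f ∗ f*` at `1` is `∑ₓ |f(x)|²`. -/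
theorem conv_self_convStar_ne_zero {f : G → ℂ} (hf : f ≠ 0) : conv f (convStar f) ≠ 0 := by
  intro h
  apply hf
  have h1 : ∑ x, ‖f x‖ ^ 2 = 0 := by
    have h2 := congrFun h 1
    simp only [conv, convStar, mul_one, inv_inv, Complex.mul_conj', Pi.zero_apply] at h2
    exact_mod_cast h2
  ext x
  simpa using (Finset.sum_eq_zero_iff_of_nonneg (fun _ _ => by positivity)).1 h1 x
    (Finset.mem_univ x)

end Convolution

/-! ### Irreducible characters: orthogonality and semisimplicity -/

section Characters

variable {G : Type*} [Group G]

theorem irr.isClassFunction (χ : irr G) : IsClassFunction (χ : G → ℂ) := by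
  obtain ⟨_, n, ρ, _, rfl⟩ := χ
  exact fun g x => ρ.char_conj g x

theorem irr.exists_apply_one (χ : irr G) : ∃ n : ℕ, n ≠ 0 ∧ (χ : G → ℂ) 1 = n := by
  obtain ⟨_, n, ρ, hρ, rfl⟩ := χ
  refine ⟨n, ?_, by simp⟩
  rintro rfl
  have hbot : (⊥ : Subrepresentation ρ) = ⊤ := by
    ext v
    have := Subsingleton.elim v 0
    subst this
    exact ⟨fun _ => (⊤ : Subrepresentation ρ).toSubmodule.zero_mem,
      fun _ => (⊥ : Subrepresentation ρ).toSubmodule.zero_mem⟩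
  exact bot_ne_top hbot

theorem irr.apply_one_ne_zero (χ : irr G) : (χ : G → ℂ) 1 ≠ 0 := by
  obtain ⟨n, hn, h⟩ := irr.exists_apply_one χ
  rw [h]; exact_mod_cast hn

theorem card_cast_ne_zero [Finite G] : (Nat.card G : ℂ) ≠ 0 := by
  exact_mod_cast Nat.card_pos.ne'

variable [Fintype G]

open Classical in
theorem irr.orthogonality (χ ψ : irr G) :
    ∑ g, (χ : G → ℂ) g * (ψ : G → ℂ) g⁻¹ = if χ = ψ then (Nat.card G : ℂ) else 0 := by
  have : Invertible (Nat.card G : ℂ) := invertibleOfNonzero card_cast_ne_zero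
  split_ifs with h
  · subst h
    obtain ⟨_, n, ρ, hρ, rfl⟩ := χ
    have := Representation.char_orthonormal ρ ρ
    rw [if_pos ⟨Representation.Equiv.refl ρ⟩] at this
    rwa [inv_mul_eq_iff_eq_mul₀ card_cast_ne_zero, mul_one] at this
  · obtain ⟨_, n, ρ, hρ, rfl⟩ := χ
    obtain ⟨_, m, σ, hσ, rfl⟩ := ψ
    have := Representation.char_orthonormal ρ σ
    rw [if_neg] at this
    · rwa [inv_mul_eq_iff_eq_mul₀ card_cast_ne_zero, mul_zero] at this
    · rintro ⟨e⟩
      exact h (Subtype.ext (Representation.char_iso e).symm)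

instance : Finite (irr G) := by
  have hli : LinearIndependent ℂ ((↑) : irr G → G → ℂ) := by
    rw [linearIndependent_iff']
    intro s a ha ψ hψ
    have h1 : ∑ g, (∑ χ ∈ s, a χ • (χ : G → ℂ)) g * (ψ : G → ℂ) g⁻¹ = 0 := by
      rw [ha]; simp
    simp only [Finset.sum_apply, Pi.smul_apply, smul_eq_mul, Finset.sum_mul, mul_assoc] at h1
    rw [Finset.sum_comm] at h1
    simp only [← Finset.mul_sum, irr.orthogonality, mul_ite, mul_zero] at h1
    simpa [hψ, card_cast_ne_zero] using h1
  exact hli.finite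

noncomputable instance : Fintype (irr G) := Fintype.ofFinite _

/-- The endomorphism `∑_g f(g) ρ(g⁻¹)` attached to a function `f` and a representation `ρ`. -/
noncomputable def Representation.convAction {n : ℕ} (ρ : Representation ℂ G (Fin n → ℂ))
    (f : G → ℂ) : Module.End ℂ (Fin n → ℂ) := ∑ g, f g • ρ g⁻¹

/-- The action is by `ρ(g⁻¹)`, so it reverses products. -/
theorem Representation.convAction_conv {n : ℕ} (ρ : Representation ℂ G (Fin n → ℂ))
    (f h : G → ℂ) : ρ.convAction (conv f h) = ρ.convAction h * ρ.convAction f := by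
  simp only [convAction, conv, Finset.sum_smul, Finset.sum_mul_sum]
  rw [Finset.sum_comm, Finset.sum_comm (s := Finset.univ) (t := Finset.univ)
    (f := fun i j => h i • ρ i⁻¹ * f j • ρ j⁻¹)]
  refine Finset.sum_congr rfl fun x _ => ?_
  refine Fintype.sum_equiv (Equiv.mulLeft x⁻¹) _ _ fun y => ?_
  simp [smul_smul, ← map_mul]

theorem Representation.trace_convAction {n : ℕ} (ρ : Representation ℂ G (Fin n → ℂ))
    (f : G → ℂ) : LinearMap.trace ℂ _ (ρ.convAction f) = ∑ g, f g * ρ.character g⁻¹ := by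
  simp [convAction, character]

/-- Schur's lemma: a class function acts on an irreducible representation by the scalar
`(∑_g f(g) χ(g⁻¹)) / χ(1)`. -/
theorem Representation.convAction_eq_smul {n : ℕ} (ρ : Representation ℂ G (Fin n → ℂ))
    [ρ.IsIrreducible] {f : G → ℂ} (hf : IsClassFunction f) :
    ρ.convAction f = ((∑ g, f g * ρ.character g⁻¹) / ρ.character 1) • 1 := by
  have hcomm : ∀ x, ρ.convAction f * ρ x = ρ x * ρ.convAction f := by
    intro x
    simp only [convAction, Finset.sum_mul, Finset.mul_sum, smul_mul_assoc, mul_smul_comm,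
      ← map_mul]
    refine Fintype.sum_equiv (MulAut.conj x⁻¹).toEquiv _ _ fun y => ?_
    have := hf y x⁻¹
    simp only [inv_inv, MulAut.conj_apply, MulEquiv.toEquiv_eq_coe, MulEquiv.coe_toEquiv,
      mul_inv_rev] at this ⊢
    rw [this]
    simp
  let T : IntertwiningMap ρ ρ := ⟨ρ.convAction f, hcomm⟩
  obtain ⟨s, hs⟩ :=
    (IsIrreducible.algebraMap_intertwiningMap_bijective_of_isAlgClosed (ρ := ρ)).2 T
  have hT : ρ.convAction f = s • 1 := by
    have := congrArg IntertwiningMap.toLinearMap hs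
    rw [Algebra.algebraMap_eq_smul_one] at this
    exact this.symm
  have h1 : ρ.character 1 ≠ 0 := irr.apply_one_ne_zero ⟨_, n, ρ, inferInstance, rfl⟩
  rw [← trace_convAction, hT]
  congr 1
  rw [map_smul, smul_eq_mul, eq_div_iff h1, character, map_one]

/-- Semisimplicity of the group algebra: a function that acts as zero on every irreducible
representation is zero. -/
theorem eq_zero_of_convAction_eq_zero {f : G → ℂ}
    (hf : ∀ (n : ℕ) (ρ : Representation ℂ G (Fin n → ℂ)), ρ.IsIrreducible →
      ρ.convAction f = 0) : f = 0 := by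
  classical
  have : NeZero (Nat.card G : ℂ) := ⟨card_cast_ne_zero⟩
  obtain ⟨k, d, hd, ⟨φ⟩⟩ :=
    IsSemisimpleRing.exists_algEquiv_pi_matrix_of_isAlgClosed ℂ (MonoidAlgebra ℂ G)
  let a : MonoidAlgebra ℂ G := ∑ g, MonoidAlgebra.single g⁻¹ (f g)
  -- Each Wedderburn component `Φ` of `ℂ[G]` is an irreducible representation, since it maps onto
  -- a full matrix algebra; so all components of `a` vanish.
  have ha : φ a = 0 := by
    ext1 i
    let Φ : MonoidAlgebra ℂ G →ₐ[ℂ] Module.End ℂ (Fin (d i) → ℂ) :=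
      (Matrix.toLinAlgEquiv' : _ ≃ₐ[ℂ] Module.End ℂ (Fin (d i) → ℂ)).toAlgHom.comp
        ((Pi.evalAlgHom ℂ _ i).comp φ.toAlgHom)
    have hΦ : Function.Surjective Φ := by
      intro T
      refine ⟨φ.symm (Pi.single i (LinearMap.toMatrixAlgEquiv' T)), ?_⟩
      simp [Φ]
    let ρ : Representation ℂ G (Fin (d i) → ℂ) :=
      (MonoidAlgebra.lift ℂ _ G).symm Φ
    have hΦρ : ∀ b, ρ.asAlgebraHom b = Φ b := by
      intro b
      rw [Representation.asAlgebraHom_def, Equiv.apply_symm_apply]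
    have hirr : ρ.IsIrreducible := by
      have := hd i
      have : Nontrivial (Subrepresentation ρ) := by
        refine ⟨⊥, ⊤, fun h => ?_⟩
        have h1 : (fun _ => 1 : Fin (d i) → ℂ) ∈ (⊥ : Subrepresentation ρ) := by
          rw [h]; exact Submodule.mem_top
        have h2 : (fun _ => 1 : Fin (d i) → ℂ) = 0 := (Submodule.mem_bot ℂ).1 h1
        exact one_ne_zero (congrFun h2 0)
      refine ⟨fun W => ?_⟩
      by_cases hW : W.toSubmodule = ⊥
      · exact Or.inl (Subrepresentation.toSubmodule_injective hW)
      · right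
        apply Subrepresentation.toSubmodule_injective
        obtain ⟨w, hw, hw0⟩ := Submodule.exists_mem_ne_zero_of_ne_bot hW
        refine eq_top_iff.2 fun v _ => ?_
        obtain ⟨T, hT⟩ : ∃ T : Module.End ℂ (Fin (d i) → ℂ), T w = v := by
          obtain ⟨l, hl⟩ : ∃ l : Module.Dual ℂ (Fin (d i) → ℂ), l w ≠ 0 := by
            by_contra! h
            exact hw0 ((Module.forall_dual_apply_eq_zero_iff ℂ w).1 h)
          exact ⟨l.smulRight ((l w)⁻¹ • v), by simp [hl]⟩
        obtain ⟨b, rfl⟩ := hΦ T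
        rw [← hT]
        have hstab : ∀ b, ∀ u ∈ W.toSubmodule, Φ b u ∈ W.toSubmodule := by
          intro b
          induction b using MonoidAlgebra.induction_on with
          | of g => exact fun u hu => W.apply_mem_toSubmodule g hu
          | add x y hx hy =>
            intro u hu
            rw [map_add]
            exact W.toSubmodule.add_mem (hx u hu) (hy u hu)
          | smul r x hx =>
            intro u hu
            rw [map_smul]
            exact W.toSubmodule.smul_mem r (hx u hu)
        exact hstab b w hw
    have h0 := hf _ ρ hirr
    have h1 : Φ a = 0 := by
      rw [← h0, Representation.convAction, ← hΦρ]
      simp [a]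
    exact (Matrix.toLinAlgEquiv' : _ ≃ₐ[ℂ] Module.End ℂ (Fin (d i) → ℂ)).injective
      (by simpa [Φ] using h1)
  have ha' : a = 0 := by simpa using ha
  ext g
  have h2 := congrArg (fun b => b.coeff g⁻¹) ha'
  simpa [a, MonoidAlgebra.coeff_sum, Finsupp.single_apply, inv_inj] using h2

end Characters

/-! ### Class functions as a copy of `ℂ^Irr(G)` -/

section Fourier

variable {G : Type*} [Group G] [Fintype G]

/-- The scalar by which a class function `f` acts on the irreducible representations with
character `χ`, namely `(∑_g f(g) χ(g⁻¹)) / χ(1)`. -/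
noncomputable def charTransform (f : G → ℂ) (χ : irr G) : ℂ :=
  (∑ g, f g * (χ : G → ℂ) g⁻¹) / (χ : G → ℂ) 1

/-- The linear map `c ↦ ∑_χ c(χ) χ(1) χ / |G|`, which sends the pointwise idempotents of `ℂ^Irr(G)`
to the primitive idempotents of the convolution algebra of class functions. -/
noncomputable def charTransformInv : (irr G → ℂ) →ₗ[ℂ] (G → ℂ) where
  toFun c g := (Nat.card G : ℂ)⁻¹ * ∑ χ : irr G, c χ * ((χ : G → ℂ) 1 * (χ : G → ℂ) g)
  map_add' c d := by
    ext g
    simp [add_mul, Finset.sum_add_distrib, mul_add]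
  map_smul' a c := by
    ext g
    simp only [Pi.smul_apply, smul_eq_mul, RingHom.id_apply, Finset.mul_sum]
    exact Finset.sum_congr rfl fun _ _ => by ring

theorem charTransformInv_apply (c : irr G → ℂ) (g : G) : charTransformInv c g =
    (Nat.card G : ℂ)⁻¹ * ∑ χ : irr G, c χ * ((χ : G → ℂ) 1 * (χ : G → ℂ) g) := rfl

theorem isClassFunction_charTransformInv (c : irr G → ℂ) :
    IsClassFunction (charTransformInv c) := by
  intro g x
  simp only [charTransformInv_apply, irr.isClassFunction _ g x]

@[simp] theorem charTransform_charTransformInv (c : irr G → ℂ) :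
    charTransform (charTransformInv c) = c := by
  ext ψ
  rw [charTransform, div_eq_iff (irr.apply_one_ne_zero ψ)]
  simp only [charTransformInv_apply, mul_assoc, Finset.sum_mul]
  rw [← Finset.mul_sum, Finset.sum_comm]
  simp only [← Finset.mul_sum, irr.orthogonality, mul_ite, mul_zero]
  simp only [Finset.sum_ite_eq', Finset.mem_univ, if_true]
  field_simp [card_cast_ne_zero (G := G)]

theorem charTransformInv_injective : Function.Injective (charTransformInv (G := G)) :=
  Function.LeftInverse.injective charTransform_charTransformInv

theorem Representation.convAction_eq_charTransform_smul {n : ℕ} (ρ : Representation ℂ G (Fin n → ℂ))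
    (hρ : ρ.IsIrreducible) {f : G → ℂ} (hf : IsClassFunction f) :
    ρ.convAction f = charTransform f ⟨ρ.character, n, ρ, hρ, rfl⟩ • 1 :=
  ρ.convAction_eq_smul hf

/-- Completeness: every class function is a linear combination of irreducible characters. -/
theorem charTransformInv_charTransform {f : G → ℂ} (hf : IsClassFunction f) :
    charTransformInv (charTransform f) = f := by
  rw [← sub_eq_zero]
  refine eq_zero_of_convAction_eq_zero fun n ρ hρ => ?_
  have h1 : ρ.convAction (charTransformInv (charTransform f) - f) =
      ρ.convAction (charTransformInv (charTransform f)) - ρ.convAction f := by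
    simp only [Representation.convAction, ← Finset.sum_sub_distrib]
    exact Finset.sum_congr rfl fun _ _ => by
      rw [Pi.sub_apply]; module
  rw [h1, ρ.convAction_eq_charTransform_smul hρ hf,
    ρ.convAction_eq_charTransform_smul hρ (isClassFunction_charTransformInv _),
    charTransform_charTransformInv, sub_self]

theorem charTransform_conv {f h : G → ℂ} (hf : IsClassFunction f) (hh : IsClassFunction h) :
    charTransform (conv f h) = charTransform f * charTransform h := by
  ext ⟨_, n, ρ, hρ, rfl⟩
  have h1 := ρ.convAction_conv f h
  rw [ρ.convAction_eq_charTransform_smul hρ hf, ρ.convAction_eq_charTransform_smul hρ hh,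
    ρ.convAction_eq_charTransform_smul hρ (hf.conv hh), smul_mul_smul_comm, one_mul] at h1
  have h2 := congrArg (LinearMap.trace ℂ _) h1
  have h3 : (Module.finrank ℂ (Fin n → ℂ) : ℂ) ≠ 0 := by
    rw [← ρ.char_one]
    exact irr.apply_one_ne_zero ⟨_, n, ρ, hρ, rfl⟩
  rw [map_smul, map_smul, LinearMap.trace_one, smul_eq_mul, smul_eq_mul] at h2
  rw [mul_right_cancel₀ h3 h2, Pi.mul_apply, mul_comm]

/-- The transform turns pointwise multiplication into convolution. -/
theorem conv_charTransformInv (c d : irr G → ℂ) :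
    conv (charTransformInv c) (charTransformInv d) = charTransformInv (c * d) := by
  have hc := isClassFunction_charTransformInv c
  have hd := isClassFunction_charTransformInv d
  rw [← charTransformInv_charTransform (hc.conv hd), charTransform_conv hc hd,
    charTransform_charTransformInv, charTransform_charTransformInv]

open Classical in
/-- The sum of the primitive idempotents is the unit of convolution, that is, the regular
character is `|G|` at `1` and zero elsewhere. -/
theorem charTransformInv_one : charTransformInv (1 : irr G → ℂ) = Pi.single 1 1 := by
  have h : IsClassFunction (Pi.single 1 1 : G → ℂ) := by
    intro g x
    simp [Pi.single_apply]
  rw [← charTransformInv_charTransform h]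
  congr 1
  ext χ
  simp [charTransform, Pi.single_apply, irr.apply_one_ne_zero χ]

/-- The primitive idempotent attached to an irreducible character is self-adjoint; equivalently
`χ(g⁻¹)` is the complex conjugate of `χ(g)`. -/
theorem convStar_charTransformInv_single [DecidableEq (irr G)] (χ : irr G) :
    convStar (charTransformInv (Pi.single χ 1)) = charTransformInv (Pi.single χ 1) := by
  set e : G → ℂ := charTransformInv (Pi.single χ 1) with he
  have hecl : IsClassFunction e := isClassFunction_charTransformInv _
  have he0 : e ≠ 0 := by
    rw [he, Ne, LinearMap.map_eq_zero_iff _ charTransformInv_injective]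
    simp
  set u := charTransform (convStar e) with hu
  have hstar : convStar e = charTransformInv u :=
    (charTransformInv_charTransform hecl.convStar).symm
  have hidem : conv e e = e := by
    rw [he, conv_charTransformInv, ← Pi.single_mul, one_mul]
  have huu : u * u = u := by
    apply charTransformInv_injective
    rw [← conv_charTransformInv, ← hstar, ← convStar_conv, hidem]
  have hprod : conv e (convStar e) = charTransformInv (Pi.single χ (u χ)) := by
    rw [hstar, he, conv_charTransformInv]
    congr 1
    ext ψ
    by_cases h : ψ = χ
    · subst h; simp
    · simp [h]
  -- `e ∗ e*` is nonzero by positivity, so the idempotent `e*` has a component at `χ`.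
  have huχ : u χ = 1 := by
    have h1 : u χ ≠ 0 := by
      intro h0
      exact conv_self_convStar_ne_zero he0 (by rw [hprod, h0, Pi.single_zero, map_zero])
    exact mul_left_cancel₀ h1 (by simpa using congrFun huu χ)
  -- Hence `e ∗ e* = e`, whose left-hand side is self-adjoint.
  rw [huχ] at hprod
  calc convStar e = convStar (conv e (convStar e)) := by rw [hprod]
    _ = conv e (convStar e) := by rw [convStar_conv, convStar_convStar]
    _ = e := hprod

theorem convStar_charTransformInv (c : irr G → ℂ) :
    convStar (charTransformInv c) = charTransformInv (star c) := by
  classical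
  have hc : charTransformInv c = ∑ χ, c χ • charTransformInv (Pi.single χ 1) := by
    simp only [← map_smul, ← map_sum]
    congr 1
    ext ψ
    simp [Pi.single_apply]
  have hc' : charTransformInv (star c) = ∑ χ, star c χ • charTransformInv (Pi.single χ 1) := by
    simp only [← map_smul, ← map_sum]
    congr 1
    ext ψ
    simp [Pi.single_apply]
  ext g
  rw [hc, hc']
  simp only [convStar, Finset.sum_apply, Pi.smul_apply, smul_eq_mul, map_sum, map_mul,
    Pi.star_apply]
  refine Finset.sum_congr rfl fun χ _ => ?_
  have := congrFun (convStar_charTransformInv_single χ) g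
  rw [convStar] at this
  rw [this]
  rfl

open Classical in
theorem sigma_apply (X : Set (irr G)) (g : G) :
    sigma X g = ∑ χ : irr G, if χ ∈ X then (χ : G → ℂ) 1 * (χ : G → ℂ) g else 0 := by
  rw [sigma, finsum_mem_eq_toFinset_sum, ← Finset.sum_filter]
  congr 1
  ext
  simp

theorem sigma_eq_charTransformInv (X : Set (irr G)) :
    sigma X = (Nat.card G : ℂ) • charTransformInv (X.indicator 1) := by
  classical
  ext g
  rw [sigma_apply, Pi.smul_apply, charTransformInv_apply, smul_eq_mul,
    mul_inv_cancel_left₀ card_cast_ne_zero]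
  refine Finset.sum_congr rfl fun χ _ => ?_
  by_cases h : χ ∈ X <;> simp [h]

end Fourier

/-! ### Algebras of functions constant on the classes of an equivalence relation -/

section ConstFun

variable {α : Type*}

/-- The algebra of complex functions that are constant on the classes of an equivalence relation,
with pointwise operations. -/
def Setoid.constFun (r : Setoid α) : Subalgebra ℂ (α → ℂ) where
  carrier := {f | ∀ a b, r a b → f a = f b}
  mul_mem' hf hg a b h := by simp [hf a b h, hg a b h]
  add_mem' hf hg a b h := by simp [hf a b h, hg a b h]
  algebraMap_mem' _ _ _ _ := rfl

theorem Setoid.indicator_mem_constFun {r : Setoid α} {X : Set α}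
    (hX : ∀ a b, r a b → (a ∈ X ↔ b ∈ X)) : X.indicator 1 ∈ r.constFun := by
  classical
  intro a b h
  simp [Set.indicator_apply, hX a b h]

theorem Setoid.finrank_constFun [Finite α] (r : Setoid α) :
    Module.finrank ℂ r.constFun = Nat.card (Quotient r) := by
  have := Fintype.ofFinite (Quotient r)
  let e : (Quotient r → ℂ) ≃ₗ[ℂ] r.constFun :=
    { toFun := fun f => ⟨fun a => f (Quotient.mk r a),
        fun a b h => congrArg f (Quotient.sound h)⟩
      invFun := fun f q => Quotient.lift f.1 f.2 q
      left_inv := fun f => by ext q; induction q using Quotient.ind; rfl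
      right_inv := fun f => rfl
      map_add' := fun _ _ => rfl
      map_smul' := fun _ _ => rfl }
  rw [← e.finrank_eq, Module.finrank_fintype_fun_eq_card, Nat.card_eq_fintype_card]

/-- Two points are related when no function in the algebra `B` separates them. -/
def Subalgebra.fiberSetoid (B : Subalgebra ℂ (α → ℂ)) : Setoid α where
  r a b := ∀ f ∈ B, f a = f b
  iseqv := ⟨fun _ _ _ => rfl, fun h f hf => (h f hf).symm,
    fun h h' f hf => (h f hf).trans (h' f hf)⟩

/-- Stone–Weierstrass for finite sets: a subalgebra of `ℂ^α` consists of all functions constant on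
the classes of the relation it defines. -/
theorem Subalgebra.constFun_fiberSetoid [Finite α] (B : Subalgebra ℂ (α → ℂ)) :
    B.fiberSetoid.constFun = B := by
  classical
  have := Fintype.ofFinite α
  refine le_antisymm (fun f hf => ?_) fun f hf a b h => h f hf
  have hsep : ∀ a b, ∃ p ∈ B, p a = 1 ∧ (¬ B.fiberSetoid a b → p b = 0) := by
    intro a b
    by_cases h : B.fiberSetoid a b
    · exact ⟨1, B.one_mem, rfl, fun h' => (h' h).elim⟩
    · have : ∃ q ∈ B, q a ≠ q b := by
        by_contra! h'
        exact h h'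
      obtain ⟨q, hq, hab⟩ := this
      refine ⟨(q a - q b)⁻¹ • (q - algebraMap ℂ _ (q b)),
        B.smul_mem (B.sub_mem hq (B.algebraMap_mem _)) _, ?_, fun _ => ?_⟩
      · simp [sub_ne_zero.2 hab]
      · simp
  choose p hpB hp1 hp0 using hsep
  -- The indicator function of the class of `a`.
  have hind : ∀ a, (fun b => if B.fiberSetoid a b then (1 : ℂ) else 0) ∈ B := by
    intro a
    have : (fun b => if B.fiberSetoid a b then (1 : ℂ) else 0) = ∏ c, p a c := by
      ext b
      rw [Finset.prod_apply]
      split_ifs with h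
      · exact (Finset.prod_eq_one fun c _ => by rw [← h _ (hpB a c), hp1]).symm
      · exact (Finset.prod_eq_zero (f := fun c => p a c b) (Finset.mem_univ b) (hp0 a b h)).symm
    rw [this]
    exact B.prod_mem fun c _ => hpB a c
  have hsum : f = ∑ q : Quotient B.fiberSetoid,
      f q.out • fun b => if B.fiberSetoid q.out b then (1 : ℂ) else 0 := by
    ext b
    simp only [Finset.sum_apply, Pi.smul_apply, smul_eq_mul, mul_ite, mul_one, mul_zero]
    rw [Finset.sum_eq_single (Quotient.mk _ b)]
    · have h : B.fiberSetoid (Quotient.mk B.fiberSetoid b).out b := Quotient.mk_out b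
      rw [if_pos h]
      exact (hf _ _ h).symm
    · intro q _ hq
      refine if_neg fun h => hq ?_
      rw [← Quotient.out_eq q]
      exact Quotient.sound h
    · simp
  rw [hsum]
  exact B.sum_mem fun q _ => B.smul_mem (hind _) _

end ConstFun

/-! ### The algebra of functions constant on superclasses -/

theorem Setoid.card_quotient_eq_encard_classes {α : Type*} [Finite α] (r : Setoid α) :
    r.classes.encard = Nat.card (Quotient r) := by
  have : Finite r.classes := Finite.of_equiv _ r.quotientEquivClasses
  rw [Nat.card_congr r.quotientEquivClasses, Nat.card_coe_set_eq, Set.Finite.cast_ncard_eq]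
  exact Set.toFinite _

theorem Setoid.mem_classes_iff_rel {α : Type*} {r : Setoid α} {K : Set α} (hK : K ∈ r.classes)
    {a b : α} (ha : a ∈ K) : b ∈ K ↔ r a b := by
  obtain ⟨y, rfl⟩ := hK
  exact ⟨fun hb => r.trans ha (r.symm hb), fun h => r.trans (r.symm h) ha⟩

namespace SupercharacterTheory

section

variable {G : Type*} [Group G]

/-- The equivalence relation on `G` whose classes are the superclasses. -/
def classRel (S : SupercharacterTheory G) : Setoid G :=
  Setoid.mkClasses S.classes S.classes_isPartition.2

/-- The equivalence relation on `Irr(G)` whose classes are the parts of the partition. -/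
def charRel (S : SupercharacterTheory G) : Setoid (irr G) :=
  Setoid.mkClasses S.charParts S.charParts_isPartition.2

theorem classes_classRel (S : SupercharacterTheory G) : S.classRel.classes = S.classes :=
  Setoid.classes_mkClasses _ S.classes_isPartition

theorem classes_charRel (S : SupercharacterTheory G) : S.charRel.classes = S.charParts :=
  Setoid.classes_mkClasses _ S.charParts_isPartition

theorem mem_cl {S : SupercharacterTheory G} {g x : G} : x ∈ S.cl g ↔ S.classRel g x := by
  rw [Setoid.rel_iff_exists_classes, classes_classRel]
  rfl

theorem eq_one_of_rel_one {S : SupercharacterTheory G} {x : G} (h : S.classRel 1 x) : x = 1 :=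
  h _ S.singleton_one_mem rfl

theorem isSNormal_iff {S : SupercharacterTheory G} {N : Subgroup G} :
    S.IsSNormal N ↔ ∀ g h, S.classRel g h → g ∈ N → h ∈ N := by
  constructor
  · rintro ⟨𝒦, h𝒦, hN⟩ g h hgh hg
    rw [← SetLike.mem_coe, hN] at hg ⊢
    obtain ⟨K, hK, hgK⟩ := hg
    exact ⟨K, hK, hgh K (h𝒦 hK) hgK⟩
  · intro h
    refine ⟨{K ∈ S.classes | K ⊆ N}, fun K hK => hK.1, ?_⟩
    refine Set.Subset.antisymm (fun g hg => ?_) (Set.sUnion_subset fun K hK => hK.2)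
    obtain ⟨K, ⟨hK, hgK⟩, _⟩ := S.classes_isPartition.2 g
    refine ⟨K, ⟨hK, fun x hx => h g x ?_ hg⟩, hgK⟩
    rw [← classes_classRel] at hK
    exact (Setoid.mem_classes_iff_rel hK hgK).1 hx

variable [Fintype G]

omit [Fintype G] in
theorem sigma_mem_constFun {S : SupercharacterTheory G} {X : Set (irr G)}
    (hX : X ∈ S.charParts) : sigma X ∈ S.classRel.constFun := by
  intro g h hgh
  obtain ⟨K, hK, hgK, hhK⟩ := S.classRel.rel_iff_exists_classes.1 hgh
  rw [classes_classRel] at hK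
  exact S.sigma_const X hX K hK g hgK h hhK

theorem charTransformInv_mem_span {S : SupercharacterTheory G} {c : irr G → ℂ}
    (hc : c ∈ S.charRel.constFun) : charTransformInv c ∈ Submodule.span ℂ S.supercharacters := by
  classical
  have key : charTransformInv c = (Nat.card G : ℂ)⁻¹ •
      ∑ q : Quotient S.charRel, c q.out • sigma {χ | Quotient.mk S.charRel χ = q} := by
    ext x
    simp only [charTransformInv_apply, Pi.smul_apply, Finset.sum_apply, smul_eq_mul]
    rw [← Finset.sum_fiberwise Finset.univ (fun χ => Quotient.mk S.charRel χ)]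
    congr 1
    refine Finset.sum_congr rfl fun q _ => ?_
    rw [sigma_apply, Finset.sum_filter, Finset.mul_sum]
    refine Finset.sum_congr rfl fun χ _ => ?_
    by_cases hχ : Quotient.mk S.charRel χ = q
    · have : S.charRel χ q.out := Quotient.exact (by rw [Quotient.out_eq, hχ])
      simp [hχ, hc _ _ this]
    · simp [hχ]
  rw [key]
  refine Submodule.smul_mem _ _ (Submodule.sum_mem _ fun q _ => Submodule.smul_mem _ _
    (Submodule.subset_span ⟨_, ?_, rfl⟩))
  rw [← classes_charRel]
  refine ⟨q.out, ?_⟩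
  ext χ
  rw [Set.mem_ofPred_eq, Set.mem_ofPred_eq]
  conv_lhs => rw [← Quotient.out_eq q]
  exact Quotient.eq

omit [Fintype G] in
theorem span_supercharacters_le (S : SupercharacterTheory G) :
    Submodule.span ℂ S.supercharacters ≤ Subalgebra.toSubmodule S.classRel.constFun := by
  rw [Submodule.span_le]
  rintro _ ⟨X, hX, rfl⟩
  exact sigma_mem_constFun hX

/-- The functions that are constant on superclasses correspond to the functions that are constant
on the parts of `Irr(G)`: both spaces have the same dimension, by `|𝒳| = |𝒴|`. -/
theorem map_constFun_charRel (S : SupercharacterTheory G) :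
    (Subalgebra.toSubmodule S.charRel.constFun).map charTransformInv =
      Subalgebra.toSubmodule S.classRel.constFun := by
  apply Submodule.eq_of_le_of_finrank_eq
  · rintro _ ⟨c, hc, rfl⟩
    exact S.span_supercharacters_le (charTransformInv_mem_span hc)
  · rw [← (Submodule.equivMapOfInjective _ charTransformInv_injective _).finrank_eq]
    have h := S.encard_eq
    rw [← classes_charRel, ← classes_classRel, Setoid.card_quotient_eq_encard_classes,
      Setoid.card_quotient_eq_encard_classes] at h
    have h1 := S.charRel.finrank_constFun
    have h2 := S.classRel.finrank_constFun
    exact h1.trans ((by exact_mod_cast h : _ = _) |>.trans h2.symm)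

theorem mem_constFun_classRel_iff {S : SupercharacterTheory G} {f : G → ℂ} :
    f ∈ S.classRel.constFun ↔ ∃ c ∈ S.charRel.constFun, charTransformInv c = f := by
  rw [← Subalgebra.mem_toSubmodule, ← map_constFun_charRel]
  rfl

theorem isClassFunction_of_mem {S : SupercharacterTheory G} {f : G → ℂ}
    (hf : f ∈ S.classRel.constFun) : IsClassFunction f := by
  obtain ⟨c, -, rfl⟩ := mem_constFun_classRel_iff.1 hf
  exact isClassFunction_charTransformInv c

theorem conv_mem_constFun {S : SupercharacterTheory G} {f h : G → ℂ}
    (hf : f ∈ S.classRel.constFun) (hh : h ∈ S.classRel.constFun) :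
    conv f h ∈ S.classRel.constFun := by
  obtain ⟨c, hc, rfl⟩ := mem_constFun_classRel_iff.1 hf
  obtain ⟨d, hd, rfl⟩ := mem_constFun_classRel_iff.1 hh
  exact mem_constFun_classRel_iff.2 ⟨c * d, mul_mem hc hd, (conv_charTransformInv c d).symm⟩

theorem convStar_mem_constFun {S : SupercharacterTheory G} {f : G → ℂ}
    (hf : f ∈ S.classRel.constFun) : convStar f ∈ S.classRel.constFun := by
  obtain ⟨c, hc, rfl⟩ := mem_constFun_classRel_iff.1 hf
  exact mem_constFun_classRel_iff.2
    ⟨star c, fun a b h => congrArg star (hc a b h), (convStar_charTransformInv c).symm⟩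

omit [Fintype G] in
theorem indicator_class_mem (S : SupercharacterTheory G) (g : G) :
    {x | S.classRel g x}.indicator 1 ∈ S.classRel.constFun :=
  Setoid.indicator_mem_constFun fun _ _ h =>
    ⟨fun h' => S.classRel.trans h' h, fun h' => S.classRel.trans h' (S.classRel.symm h)⟩

theorem rel_conj (S : SupercharacterTheory G) (g x : G) : S.classRel g (x * g * x⁻¹) := by
  classical
  have h := isClassFunction_of_mem (S.indicator_class_mem g) g x
  by_contra hn
  simp [hn] at h

theorem rel_inv {S : SupercharacterTheory G} {g h : G} (hgh : S.classRel g h) :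
    S.classRel g⁻¹ h⁻¹ := by
  classical
  have h := convStar_mem_constFun (S.indicator_class_mem g⁻¹) g h hgh
  by_contra hn
  simp [convStar, hn] at h

/-- The product of two superclasses is a union of superclasses. -/
theorem exists_rel_mul {S : SupercharacterTheory G} {g h v : G} (hv : S.classRel (g * h) v) :
    ∃ g' h', S.classRel g g' ∧ S.classRel h h' ∧ v = g' * h' := by
  classical
  have key := conv_mem_constFun (S.indicator_class_mem g) (S.indicator_class_mem h) _ _ hv
  by_contra! hn
  have h0 : conv ({x | S.classRel g x}.indicator 1) ({x | S.classRel h x}.indicator 1) v = 0 := by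
    refine Finset.sum_eq_zero fun x _ => ?_
    by_cases hx : S.classRel g x
    · have : ¬ S.classRel h (x⁻¹ * v) := fun h' => hn x _ hx h' (by simp)
      simp [Set.indicator_apply, this]
    · simp [Set.indicator_apply, hx]
  rw [h0] at key
  simp only [conv, Set.indicator_apply, Set.mem_ofPred_eq, Pi.one_apply, mul_ite, mul_one, mul_zero,
    ← ite_and, Finset.sum_boole, Nat.cast_eq_zero, Finset.card_eq_zero] at key
  have : g ∈ (∅ : Finset G) := by
    rw [← key]
    simp
  simp at this

end

/-- A partition of a finite group into unions of conjugacy classes, with `{1}` as a part, is the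
partition into the superclasses of a supercharacter theory as soon as the functions constant on its
parts are closed under convolution: these functions correspond to a subalgebra of `ℂ^Irr(G)`, and
that subalgebra consists of the functions constant on the parts of a partition of `Irr(G)`. -/
theorem exists_classes_eq {G : Type*} [Group G] [Fintype G] (r : Setoid G)
    (hone : ∀ x, r 1 x → x = 1) (hconj : ∀ g x, r (x * g * x⁻¹) g)
    (hconv : ∀ f ∈ r.constFun, ∀ h ∈ r.constFun, conv f h ∈ r.constFun) :
    ∃ T : SupercharacterTheory G, T.classes = r.classes := by
  classical
  let B : Subalgebra ℂ (irr G → ℂ) :=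
    { carrier := {c | charTransformInv c ∈ r.constFun}
      mul_mem' := fun {c d} hc hd => by
        rw [Set.mem_ofPred_eq, ← conv_charTransformInv]
        exact hconv _ hc _ hd
      add_mem' := fun {c d} hc hd => by
        rw [Set.mem_ofPred_eq, map_add]
        exact add_mem hc hd
      algebraMap_mem' := fun a => by
        rw [Set.mem_ofPred_eq, Algebra.algebraMap_eq_smul_one, map_smul, charTransformInv_one]
        refine r.constFun.smul_mem (fun g h hgh => ?_) a
        have : g = 1 ↔ h = 1 :=
          ⟨fun hg => hone h (hg ▸ hgh), fun hh => hone g (hh ▸ r.symm hgh)⟩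
        simp [Pi.single_apply, this] }
  have hB : ∀ c, c ∈ B ↔ charTransformInv c ∈ r.constFun := fun _ => Iff.rfl
  have hmap : (Subalgebra.toSubmodule B).map charTransformInv =
      Subalgebra.toSubmodule r.constFun := by
    ext f
    refine ⟨?_, fun hf => ?_⟩
    · rintro ⟨c, hc, rfl⟩
      exact hc
    · have hcl : IsClassFunction f := fun g x => hf _ _ (hconj g x)
      exact ⟨charTransform f, (hB _).2 (by rwa [charTransformInv_charTransform hcl]),
        charTransformInv_charTransform hcl⟩
  have hcard : Nat.card (Quotient B.fiberSetoid) = Nat.card (Quotient r) := by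
    rw [← Setoid.finrank_constFun, ← Setoid.finrank_constFun, B.constFun_fiberSetoid]
    have := (Submodule.equivMapOfInjective _ (charTransformInv_injective (G := G))
      (Subalgebra.toSubmodule B)).finrank_eq
    rwa [hmap] at this
  refine ⟨⟨B.fiberSetoid.classes, r.classes, Setoid.isPartition_classes _,
    Setoid.isPartition_classes _, ⟨1, ?_⟩, ?_, ?_⟩, rfl⟩
  · ext x
    exact ⟨fun h => (Set.mem_singleton_iff.1 h) ▸ r.refl 1, fun h => hone x (r.symm h)⟩
  · rw [Setoid.card_quotient_eq_encard_classes, Setoid.card_quotient_eq_encard_classes, hcard]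
  · intro X hX K hK g hg h hh
    have hind : X.indicator 1 ∈ B := by
      rw [← B.constFun_fiberSetoid]
      refine Setoid.indicator_mem_constFun fun a b hab => ?_
      exact ⟨fun ha => (Setoid.mem_classes_iff_rel hX ha).2 hab,
        fun hb => (Setoid.mem_classes_iff_rel hX hb).2 (Setoid.symm' _ hab)⟩
    rw [sigma_eq_charTransformInv, Pi.smul_apply, Pi.smul_apply,
      (hB _).1 hind g h ((Setoid.mem_classes_iff_rel hK hg).1 hh)]

end SupercharacterTheory

/-! ### Restriction, quotients and the commutator subgroup -/

theorem QuotientGroup.sum_mk {G : Type*} [Group G] [Fintype G] (M : Subgroup G) [M.Normal]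
    [Fintype (G ⧸ M)] (F : G ⧸ M → ℂ) :
    ∑ x : G, F (x : G ⧸ M) = Nat.card M * ∑ q, F q := by
  classical
  rw [← Finset.sum_fiberwise' Finset.univ (fun x : G => (x : G ⧸ M)), Finset.mul_sum]
  refine Finset.sum_congr rfl fun q _ => ?_
  rw [Finset.sum_const, nsmul_eq_mul]
  congr 2
  have h := Nat.card_congr
    (MonoidHom.fiberEquivKerOfSurjective (QuotientGroup.mk'_surjective M) q)
  rw [QuotientGroup.ker_mk'] at h
  rw [← h]
  exact (Nat.subtype_card _ (by simp)).symm

theorem conv_indicator_subgroup {G : Type*} [Group G] [Fintype G] (M : Subgroup G) [Fintype M]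
    (f : G → ℂ) (g : G) : conv f ((M : Set G).indicator 1) g = ∑ m : M, f (g * m) := by
  classical
  symm
  refine Fintype.sum_of_injective (fun m : M => g * m) (fun a b h => by simpa using h) _ _ ?_ ?_
  · intro x hx
    have : x⁻¹ * g ∉ M := fun h => hx ⟨⟨_, M.inv_mem h⟩, by simp⟩
    simp [this]
  · intro m
    simp [mul_assoc]

namespace SupercharacterTheory

variable {G : Type*} [Group G] {S : SupercharacterTheory G} {M N : Subgroup G}

theorem classRel_eq_of_classes_eq {r : Setoid G} (h : S.classes = r.classes) : S.classRel = r := by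
  rw [Setoid.classes_inj, classes_classRel, h]

variable [Fintype G]

theorem IsSNormal.normal (hN : S.IsSNormal N) : N.Normal :=
  ⟨fun n hn g => isSNormal_iff.1 hN _ _ (S.rel_conj n g) hn⟩

/-- The restriction of a supercharacter theory to an `S`-normal subgroup: its superclasses are the
superclasses of `S` inside `N`. -/
theorem exists_restrict (hN : S.IsSNormal N) :
    ∃ C : SupercharacterTheory N, C.classRel = S.classRel.comap ((↑) : N → G) := by
  classical
  have hN' := isSNormal_iff.1 hN
  have := Fintype.ofFinite N
  -- Extension by zero turns functions constant on classes of `N` into such functions on `G`.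
  have hext : ∀ f ∈ (S.classRel.comap ((↑) : N → G)).constFun,
      Function.extend ((↑) : N → G) f 0 ∈ S.classRel.constFun := by
    intro f hf g h hgh
    by_cases hg : g ∈ N
    · have hh := hN' g h hgh hg
      rw [show g = ((⟨g, hg⟩ : N) : G) from rfl, show h = ((⟨h, hh⟩ : N) : G) from rfl,
        Subtype.val_injective.extend_apply, Subtype.val_injective.extend_apply]
      exact hf _ _ hgh
    · have hh : h ∉ N := fun hh => hg (hN' h g (S.classRel.symm hgh) hh)
      rw [Function.extend_apply', Function.extend_apply']
      · simp
      · rintro ⟨x, rfl⟩; exact hh x.2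
      · rintro ⟨x, rfl⟩; exact hg x.2
  have hconv : ∀ (f h : N → ℂ) (y : N), conv f h y = conv (Function.extend ((↑) : N → G) f 0)
      (Function.extend ((↑) : N → G) h 0) (y : G) := by
    intro f h y
    refine Fintype.sum_of_injective ((↑) : N → G) Subtype.val_injective _ _ ?_ ?_
    · intro x hx
      rw [Function.extend_apply' _ _ _ (by simpa using hx)]
      simp
    · intro x
      rw [Subtype.val_injective.extend_apply, show (x : G)⁻¹ * y = ((x⁻¹ * y : N) : G) from rfl,
        Subtype.val_injective.extend_apply]
  obtain ⟨C, hC⟩ := exists_classes_eq (S.classRel.comap ((↑) : N → G))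
    (fun x hx => Subtype.ext (eq_one_of_rel_one hx))
    (fun g x => S.classRel.symm (S.rel_conj (g : G) x))
    (fun f hf h hh a b hab => by
      rw [hconv, hconv]
      exact conv_mem_constFun (hext f hf) (hext h hh) _ _ hab)
  exact ⟨C, classRel_eq_of_classes_eq hC⟩

/-- If `g` and `h` lie in one superclass, then the superclass of any other representative `g'` of
`gM` meets `hM`, because `Cl_S(gm) ⊆ Cl_S(g)M` for `m ∈ M`. -/
theorem exists_rel_of_mk_eq (hM : S.IsSNormal M) [M.Normal] {g h g' : G} (hgh : S.classRel g h)
    (hg : (g' : G ⧸ M) = g) : ∃ h', S.classRel g' h' ∧ (h' : G ⧸ M) = h := by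
  rw [QuotientGroup.eq] at hg
  have h1 : S.classRel (g' * (g'⁻¹ * g)) h := by simpa using hgh
  obtain ⟨a, b, ha, hb, rfl⟩ := exists_rel_mul h1
  refine ⟨a, ha, ?_⟩
  rw [QuotientGroup.eq]
  simpa using isSNormal_iff.1 hM _ _ hb hg

/-- The equivalence relation on `G/M`, for an `S`-normal subgroup `M`, whose classes are the images
of the superclasses. -/
def quotientRel (hM : S.IsSNormal M) [M.Normal] : Setoid (G ⧸ M) where
  r a b := ∃ g h, S.classRel g h ∧ (g : G ⧸ M) = a ∧ (h : G ⧸ M) = b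
  iseqv := by
    refine ⟨fun a => ?_, ?_, ?_⟩
    · obtain ⟨g, rfl⟩ := QuotientGroup.mk_surjective a
      exact ⟨g, g, S.classRel.refl g, rfl, rfl⟩
    · rintro _ _ ⟨g, h, hgh, rfl, rfl⟩
      exact ⟨h, g, S.classRel.symm hgh, rfl, rfl⟩
    · rintro _ _ _ ⟨g, h, hgh, rfl, rfl⟩ ⟨h', k, hk, hh, rfl⟩
      obtain ⟨k', hk', hkk⟩ := exists_rel_of_mk_eq hM hk hh.symm
      exact ⟨g, k', S.classRel.trans hgh hk', rfl, hkk⟩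

theorem quotientRel_mk_iff (hM : S.IsSNormal M) [M.Normal] {g : G} {q : G ⧸ M} :
    quotientRel hM (g : G ⧸ M) q ↔ ∃ h, S.classRel g h ∧ (h : G ⧸ M) = q := by
  constructor
  · rintro ⟨g', h, hgh, hg, rfl⟩
    exact exists_rel_of_mk_eq hM hgh hg.symm
  · rintro ⟨h, hgh, rfl⟩
    exact ⟨g, h, hgh, rfl, rfl⟩

/-- The supercharacter theory induced on the quotient by an `S`-normal subgroup. Convolution on
`G/M` is, up to the factor `|M|`, convolution on `G` of functions pulled back along `G → G/M`. -/
theorem exists_quotient (hM : S.IsSNormal M) [M.Normal] :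
    ∃ D : SupercharacterTheory (G ⧸ M), D.classRel = quotientRel hM := by
  have := Fintype.ofFinite (G ⧸ M)
  have hpull : ∀ f ∈ (quotientRel hM).constFun,
      (fun g : G => f (g : G ⧸ M)) ∈ S.classRel.constFun :=
    fun f hf g h hgh => hf _ _ ⟨g, h, hgh, rfl, rfl⟩
  have hconv : ∀ (f h : G ⧸ M → ℂ) (g : G),
      conv (fun g : G => f (g : G ⧸ M)) (fun g : G => h (g : G ⧸ M)) g =
        Nat.card M * conv f h (g : G ⧸ M) := fun f h g =>
    QuotientGroup.sum_mk M fun q => f q * h (q⁻¹ * g)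
  obtain ⟨D, hD⟩ := exists_classes_eq (quotientRel hM)
    (fun x hx => by
      obtain ⟨h, hh, rfl⟩ := (quotientRel_mk_iff hM).1 hx
      rw [eq_one_of_rel_one hh, QuotientGroup.mk_one])
    (fun a b => by
      obtain ⟨g, rfl⟩ := QuotientGroup.mk_surjective a
      obtain ⟨x, rfl⟩ := QuotientGroup.mk_surjective b
      exact ⟨x * g * x⁻¹, g, S.classRel.symm (S.rel_conj g x), rfl, rfl⟩)
    (fun f hf h hh => by
      rintro _ _ ⟨x, y, hxy, rfl, rfl⟩
      have key := conv_mem_constFun (hpull f hf) (hpull h hh) x y hxy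
      rw [hconv, hconv] at key
      exact mul_left_cancel₀ card_cast_ne_zero key)
  exact ⟨D, classRel_eq_of_classes_eq hD⟩

omit [Fintype G] in
theorem inv_mul_mem_commutator {g k : G} (h : S.classRel g k) : g⁻¹ * k ∈ S.commutator ⊤ :=
  Subgroup.subset_closure ⟨g, Subgroup.mem_top g, k, mem_cl.2 h, rfl⟩

/-- The generating set `{g⁻¹k}` of `[G,S]` is a union of superclasses, because inverses and products
of superclasses are. -/
theorem isSNormal_commutator (S : SupercharacterTheory G) : S.IsSNormal (S.commutator ⊤) := by
  rw [isSNormal_iff]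
  intro x y hxy hx
  rw [commutator] at hx
  induction hx using Subgroup.closure_induction generalizing y with
  | mem x hx =>
    obtain ⟨g, -, k, hk, rfl⟩ := hx
    obtain ⟨a, b, ha, hb, rfl⟩ := exists_rel_mul hxy
    have h1 : S.classRel a⁻¹ b := by
      have h2 := rel_inv ha
      rw [inv_inv] at h2
      exact S.classRel.trans (S.classRel.symm h2) (S.classRel.trans (mem_cl.1 hk) hb)
    simpa using inv_mul_mem_commutator h1
  | one => rw [eq_one_of_rel_one hxy]; exact one_mem _
  | mul x₁ x₂ _ _ h₁ h₂ =>
    obtain ⟨a, b, ha, hb, rfl⟩ := exists_rel_mul hxy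
    exact mul_mem (h₁ a ha) (h₂ b hb)
  | inv x _ h =>
    have h1 := rel_inv hxy
    rw [inv_inv] at h1
    exact inv_mem_iff.1 (h _ h1)

theorem sigma_one_ne_zero {X : Set (irr G)} (hX : X.Nonempty) : sigma X 1 ≠ 0 := by
  classical
  choose n hn0 hn using irr.exists_apply_one (G := G)
  have h : sigma X 1 = ((∑ χ, if χ ∈ X then n χ * n χ else 0 : ℕ) : ℂ) := by
    rw [sigma_apply]
    push_cast
    refine Finset.sum_congr rfl fun χ _ => ?_
    rw [hn]
  obtain ⟨χ, hχ⟩ := hX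
  rw [h, Nat.cast_ne_zero]
  intro h0
  have := Finset.sum_eq_zero_iff.1 h0 χ (Finset.mem_univ χ)
  simp [hχ, hn0] at this

/-- A supercharacter is an eigenvector for convolution with any function constant on
superclasses. -/
theorem exists_conv_sigma_eq_smul {X : Set (irr G)} (hX : X ∈ S.charParts) {f : G → ℂ}
    (hf : f ∈ S.classRel.constFun) : ∃ a : ℂ, conv (sigma X) f = a • sigma X := by
  classical
  obtain ⟨c, hc, rfl⟩ := mem_constFun_classRel_iff.1 hf
  rw [← classes_charRel] at hX
  obtain ⟨χ, rfl⟩ := hX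
  refine ⟨c χ, ?_⟩
  rw [sigma_eq_charTransformInv, ← map_smul, conv_charTransformInv, ← map_smul]
  congr 1
  ext ψ
  by_cases h : S.charRel ψ χ
  · simp [h, hc _ _ h, mul_comm]
  · simp [h]

/-- Sums of a supercharacter over the cosets of an `S`-normal subgroup `M`: either it is constant
on cosets, or all its coset sums vanish. -/
theorem sigma_mul_eq_or_sum_eq_zero (hM : S.IsSNormal M) [Fintype M] {X : Set (irr G)}
    (hX : X ∈ S.charParts) :
    ((M : Set G) ⊆ {g | sigma X g = sigma X 1} ∧ ∀ g, ∀ m ∈ M, sigma X (g * m) = sigma X g) ∨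
      (¬ (M : Set G) ⊆ {g | sigma X g = sigma X 1} ∧ ∀ g, ∑ m : M, sigma X (g * m) = 0) := by
  have hind : (M : Set G).indicator 1 ∈ S.classRel.constFun :=
    Setoid.indicator_mem_constFun fun a b h => ⟨isSNormal_iff.1 hM a b h,
      isSNormal_iff.1 hM b a (S.classRel.symm h)⟩
  obtain ⟨a, ha⟩ := exists_conv_sigma_eq_smul hX hind
  have hsum : ∀ g, ∑ m : M, sigma X (g * m) = a * sigma X g := fun g => by
    rw [← conv_indicator_subgroup, ha]; rfl
  by_cases ha0 : a = 0
  · refine Or.inr ⟨fun hker => ?_, fun g => by rw [hsum, ha0, zero_mul]⟩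
    have h1 := hsum 1
    rw [Finset.sum_congr rfl fun (m : M) _ => (by
      rw [one_mul]; exact hker m.2 : sigma X (1 * (m : G)) = sigma X 1), Finset.sum_const, ha0,
      zero_mul, Finset.card_univ, nsmul_eq_mul, mul_eq_zero] at h1
    refine h1.elim (fun h => ?_) (sigma_one_ne_zero
      (Setoid.nonempty_of_mem_partition S.charParts_isPartition hX))
    exact Fintype.card_ne_zero (by exact_mod_cast h)
  · have hinv : ∀ g, ∀ m ∈ M, sigma X (g * m) = sigma X g := fun g m hm => by
      apply mul_left_cancel₀ ha0
      rw [← hsum, ← hsum]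
      refine Fintype.sum_equiv (Equiv.mulLeft (⟨m, hm⟩ : M)) _ _ fun x => ?_
      simp [mul_assoc]
    exact Or.inl ⟨fun m hm => by simpa using hinv 1 m hm, hinv⟩

end SupercharacterTheory

namespace SupercharacterTheory

variable {G : Type*} [Group G] {S : SupercharacterTheory G} {N : Subgroup G}

/-! ### Superclasses filling cosets of `[G,S]` -/

/-- A superclass `Cl_S(g)` has `|[G,S]|` elements exactly when it fills the coset `g[G,S]`. -/
theorem ncard_cl_eq_iff [Finite G] {g : G} : (S.cl g).ncard = Nat.card (S.commutator ⊤) ↔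
    ∀ z ∈ S.commutator ⊤, ∃ y ∈ S.cl g, g⁻¹ * y = z := by
  have hsub : S.cl g ⊆ (g * ·) '' (S.commutator ⊤ : Set G) := fun k hk =>
    ⟨g⁻¹ * k, inv_mul_mem_commutator (mem_cl.1 hk), by simp⟩
  have hcard : ((g * ·) '' (S.commutator ⊤ : Set G)).ncard = Nat.card (S.commutator ⊤) := by
    rw [Set.ncard_image_of_injective _ (mul_right_injective g), ← Nat.card_coe_set_eq]
    rfl
  constructor
  · intro h z hz
    have heq := Set.eq_of_subset_of_ncard_le hsub (by rw [hcard, h]) (Set.toFinite _)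
    exact ⟨g * z, heq ▸ ⟨z, hz, rfl⟩, by simp⟩
  · intro h
    rw [← hcard]
    congr 1
    refine hsub.antisymm ?_
    rintro _ ⟨z, hz, rfl⟩
    obtain ⟨y, hy, rfl⟩ := h z hz
    simpa using hy

theorem exists_mem_cl_iff_rel {g z : G} :
    (∃ y ∈ S.cl g, g⁻¹ * y = z) ↔ S.classRel g (g * z) := by
  constructor
  · rintro ⟨y, hy, rfl⟩
    simpa using mem_cl.1 hy
  · exact fun h => ⟨g * z, mem_cl.2 h, by simp⟩

variable [Fintype G]

/-- The superclass of `g` contains `gM` exactly when every supercharacter whose kernel does not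
contain `M` vanishes at `g`. -/
theorem rel_mul_iff_vanish {M : Subgroup G} (hM : S.IsSNormal M) (g : G) :
    (∀ z ∈ M, S.classRel g (g * z)) ↔ ∀ σ ∈ S.supercharactersOver M, σ g = 0 := by
  classical
  constructor
  · rintro h _ ⟨⟨X, hX, rfl⟩, hker⟩
    obtain ⟨hker', -⟩ | ⟨-, hsum⟩ := sigma_mul_eq_or_sum_eq_zero hM hX
    · exact (hker hker').elim
    · have h1 := hsum g
      rw [Finset.sum_congr rfl fun (m : M) _ => (sigma_mem_constFun hX _ _ (h m m.2)).symm,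
        Finset.sum_const, nsmul_eq_mul, mul_eq_zero] at h1
      exact h1.resolve_left (by simp)
  · intro h
    -- Averaging over `gM` fixes the value at `g` of every function constant on superclasses.
    have havg : ∀ f ∈ S.classRel.constFun, ∑ m : M, f (g * m) = Fintype.card M * f g := by
      intro f hf
      have hspan : f ∈ Submodule.span ℂ S.supercharacters := by
        obtain ⟨c, hc, rfl⟩ := mem_constFun_classRel_iff.1 hf
        exact charTransformInv_mem_span hc
      clear hf
      induction hspan using Submodule.span_induction with
      | mem f hf =>
        obtain ⟨X, hX, rfl⟩ := hf
        obtain ⟨-, hinv⟩ | ⟨hker, hsum⟩ := sigma_mul_eq_or_sum_eq_zero hM hX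
        · simp [fun m : M => hinv g m m.2]
        · rw [hsum, h _ ⟨⟨X, hX, rfl⟩, hker⟩, mul_zero]
      | zero => simp
      | add f₁ f₂ _ _ h₁ h₂ => simp [Finset.sum_add_distrib, h₁, h₂, mul_add]
      | smul a f _ hf =>
        simp only [Pi.smul_apply, smul_eq_mul, ← Finset.mul_sum, hf]
        ring
    have key := havg _ (S.indicator_class_mem g)
    simp only [Set.indicator_apply, Set.mem_ofPred_eq, Pi.one_apply, Finset.sum_boole,
      S.classRel.refl g, if_true, mul_one, Nat.cast_inj] at key
    have huniv := Finset.eq_univ_of_card _ key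
    intro z hz
    have := huniv ▸ Finset.mem_univ (⟨z, hz⟩ : M)
    exact (Finset.mem_filter.1 this).2

omit [Fintype G] in
/-- If `m ∈ [G,S]` lay outside `N`, its superclass would contain `m * m⁻¹ = 1`. -/
theorem commutator_le (h : ∀ g ∉ N, ∀ z ∈ S.commutator ⊤, S.classRel g (g * z)) :
    S.commutator ⊤ ≤ N := by
  intro m hm
  by_contra hmN
  have h1 := h m hmN m⁻¹ (inv_mem hm)
  rw [mul_inv_cancel] at h1
  exact hmN (eq_one_of_rel_one (S.classRel.symm h1) ▸ one_mem N)

/-- If every superclass outside `N` is a union of cosets of `M`, then `S` is the Δ-product of its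
restriction to `N` and its quotient by `M`. -/
theorem isDeltaProduct_of_rel_mul {M : Subgroup G} (hM : S.IsSNormal M) (hN : S.IsSNormal N)
    (hMN : M ≤ N) (h : ∀ g ∉ N, ∀ z ∈ M, S.classRel g (g * z)) : S.IsDeltaProduct M N := by
  have hMn := hM.normal
  have hN' := isSNormal_iff.1 hN
  obtain ⟨C, hC⟩ := exists_restrict hN
  obtain ⟨D, hD⟩ := exists_quotient hM
  have hCrel : ∀ x y, C.classRel x y ↔ S.classRel (x : G) y := fun x y => by rw [hC]; rfl
  have hDrel : ∀ (g : G) (q : G ⧸ M),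
      D.classRel g q ↔ ∃ k, S.classRel g k ∧ (k : G ⧸ M) = q := fun g q => by
    rw [hD]; exact quotientRel_mk_iff hM
  have hmem : ∀ g : G, (g : G ⧸ M) ∈ N.map (QuotientGroup.mk' M) ↔ g ∈ N := by
    refine fun g => ⟨?_, fun hg => ⟨g, hg, rfl⟩⟩
    rintro ⟨n, hn, hng⟩
    have h1 : n⁻¹ * g ∈ M := QuotientGroup.eq.1 hng
    simpa using mul_mem hn (hMN h1)
  have hDN : D.IsSNormal (N.map (QuotientGroup.mk' M)) := by
    rw [isSNormal_iff]
    intro a b hab ha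
    obtain ⟨g, rfl⟩ := QuotientGroup.mk_surjective a
    obtain ⟨k, hgk, rfl⟩ := (hDrel _ _).1 hab
    exact (hmem k).2 (hN' g k hgk ((hmem g).1 ha))
  -- Outside `N` the superclasses of `S` are the preimages of those of `D`.
  have hpre : ∀ y ∉ N, ((↑) : G → G ⧸ M) ⁻¹' {q | D.classRel q (y : G ⧸ M)} =
      {x | S.classRel x y} := by
    intro y hy
    ext x
    constructor
    · intro hx
      obtain ⟨k, hyk, hkx⟩ := (hDrel _ _).1 (D.classRel.symm hx)
      have hk : k ∉ N := fun hk => hy (hN' k y (S.classRel.symm hyk) hk)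
      have h1 := h k hk _ (QuotientGroup.eq.1 hkx)
      rw [mul_inv_cancel_left] at h1
      exact S.classRel.symm (S.classRel.trans hyk h1)
    · exact fun hx => D.classRel.symm ((hDrel _ _).2 ⟨x, S.classRel.symm hx, rfl⟩)
  refine ⟨hMn, C, D, hMN, ?_, ?_, hDN, ?_, ?_⟩
  · intro K hK g x hx
    refine ⟨⟨g * x * g⁻¹, hN.normal.conj_mem x x.2 g⟩, ?_, rfl⟩
    rw [← classes_classRel] at hK
    exact (Setoid.mem_classes_iff_rel hK hx).2 ((hCrel _ _).2 (S.rel_conj x g))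
  · rw [isSNormal_iff]
    exact fun x y hxy hx => isSNormal_iff.1 hM x y ((hCrel _ _).1 hxy) hx
  · rw [← classes_classRel, ← classes_classRel]
    ext L
    constructor
    · rintro ⟨_, ⟨y, rfl⟩, rfl⟩
      refine ⟨⟨(y : G), ?_⟩, ?_⟩
      · ext q
        constructor
        · rintro ⟨x, hx, rfl⟩
          exact D.classRel.symm ((hDrel _ _).2 ⟨x, S.classRel.symm ((hCrel _ _).1 hx), rfl⟩)
        · intro hq
          obtain ⟨k, hyk, rfl⟩ := (hDrel _ _).1 (D.classRel.symm hq)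
          exact ⟨⟨k, hN' _ _ hyk y.2⟩, (hCrel _ _).2 (S.classRel.symm hyk), rfl⟩
      · rintro _ ⟨x, -, rfl⟩
        exact (hmem x).2 x.2
    · rintro ⟨⟨a, rfl⟩, hL⟩
      obtain ⟨y, rfl⟩ := QuotientGroup.mk_surjective a
      have hy : y ∈ N := (hmem y).1 (hL (D.classRel.refl _))
      refine ⟨_, ⟨⟨y, hy⟩, rfl⟩, ?_⟩
      ext q
      constructor
      · rintro ⟨x, hx, rfl⟩
        exact D.classRel.symm ((hDrel _ _).2 ⟨x, S.classRel.symm ((hCrel _ _).1 hx), rfl⟩)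
      · intro hq
        obtain ⟨k, hyk, rfl⟩ := (hDrel _ _).1 (D.classRel.symm hq)
        exact ⟨⟨k, hN' _ _ hyk hy⟩, (hCrel _ _).2 (S.classRel.symm hyk), rfl⟩
  · rw [← classes_classRel, ← classes_classRel, ← classes_classRel]
    have himage : ∀ y : N, ((↑) : N → G) '' {x | C.classRel x y} = {x | S.classRel x y} := by
      intro y
      ext x
      constructor
      · rintro ⟨x, hx, rfl⟩
        exact (hCrel _ _).1 hx
      · exact fun hx => ⟨⟨x, hN' _ _ (S.classRel.symm hx) y.2⟩, (hCrel _ _).2 hx, rfl⟩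
    ext K
    constructor
    · rintro ⟨y, rfl⟩
      by_cases hy : y ∈ N
      · exact Or.inl ⟨_, ⟨⟨y, hy⟩, rfl⟩, himage ⟨y, hy⟩⟩
      · refine Or.inr ⟨_, ⟨⟨(y : G ⧸ M), rfl⟩, fun hL => hy ((hmem y).1 (hL ?_))⟩, hpre y hy⟩
        exact D.classRel.refl _
    · rintro (⟨_, ⟨y, rfl⟩, rfl⟩ | ⟨_, ⟨⟨a, rfl⟩, hL⟩, rfl⟩)
      · exact ⟨y, himage y⟩
      · obtain ⟨y, rfl⟩ := QuotientGroup.mk_surjective a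
        have hy : y ∉ N := fun hy => hL fun q hq =>
          isSNormal_iff.1 hDN _ _ (D.classRel.symm hq) ((hmem y).2 hy)
        exact ⟨y, hpre y hy⟩

omit [Fintype G] in
theorem IsDeltaProduct.rel_mul {M : Subgroup G} (hS : S.IsDeltaProduct M N) {g z : G} (hg : g ∉ N)
    (hz : z ∈ M) : S.classRel g (g * z) := by
  obtain ⟨_, C, D, hCD⟩ := hS
  obtain ⟨K, ⟨hK, hgK⟩, -⟩ := S.classes_isPartition.2 g
  have hK' := hK
  rw [hCD.classes_eq] at hK'
  obtain ⟨L, -, rfl⟩ | ⟨L, -, rfl⟩ := hK'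
  · obtain ⟨x, -, rfl⟩ := hgK
    exact (hg x.2).elim
  · refine S.classRel.rel_iff_exists_classes.2 ⟨_, by rwa [classes_classRel], hgK, ?_⟩
    have : ((g * z : G) : G ⧸ M) = g := (QuotientGroup.eq.2 (by simpa using hz)).symm
    rw [Set.mem_preimage, this]
    exact hgK

end SupercharacterTheory

theorem theorem1 {G : Type*} [Group G] [Finite G] (S : SupercharacterTheory G) (N : Subgroup G)
    (hN : S.IsSNormal N) :
    List.TFAE [
      S.IsGCP N,
      S.commutator ⊤ ≤ N ∧ S.IsDeltaProduct (S.commutator ⊤) N,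
      ∀ g ∉ N, (S.cl g).ncard = Nat.card (S.commutator ⊤),
      ∀ g ∉ N, ∀ z ∈ S.commutator ⊤, ∃ y ∈ S.cl g, g⁻¹ * y = z,
      ∀ σ ∈ S.supercharactersOver (S.commutator ⊤), ∀ g ∉ N, σ g = 0] := by
  have := Fintype.ofFinite G
  have hM := S.isSNormal_commutator
  tfae_have 1 ↔ 5 := ⟨fun h σ hσ g hg => h.2 g hg σ hσ, fun h => ⟨hN, fun g hg σ hσ => h σ hσ g hg⟩⟩
  tfae_have 3 ↔ 4 := forall₂_congr fun _ _ => SupercharacterTheory.ncard_cl_eq_iff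
  tfae_have 4 → 2 := by
    intro h
    simp only [SupercharacterTheory.exists_mem_cl_iff_rel] at h
    have hle := SupercharacterTheory.commutator_le h
    exact ⟨hle, SupercharacterTheory.isDeltaProduct_of_rel_mul hM hN hle h⟩
  tfae_have 2 → 4 := fun h g hg z hz =>
    SupercharacterTheory.exists_mem_cl_iff_rel.2 (h.2.rel_mul hg hz)
  tfae_have 4 ↔ 5 := by
    simp only [SupercharacterTheory.exists_mem_cl_iff_rel]
    exact (forall₂_congr fun g _ => SupercharacterTheory.rel_mul_iff_vanish hM g).trans
      ⟨fun h σ hσ g hg => h g hg σ hσ, fun h g hg σ hσ => h σ hσ g hg⟩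
  tfae_finish
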